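/- Let $D_6=\langle \sigma,\tau : \sigma^6=\tau^2=1,\ \tau\sigma\tau^{-1}=\sigma^{-1}\rangle$ be the dihedral group of order $12$. Let $D_6$ act on the rational function field $\mathbb{Q}(y_0,y_1,y_2)$ in three variables by the $\mathbb{Q}$-automorphisms determined by $$\sigma:\ y_0\mapsto y_1,\quad y_1\mapsto y_2,\quad y_2\mapsto -y_0;\qquad \tau:\ y_0\mapsto y_0,\quad y_1\mapsto -y_2,\quad y_2\mapsto -y_1.$$ Then the fixed field $\mathbb{Q}(y_0,y_1,y_2)^{D_6}$ is rational over $\mathbb{Q}$, that is, it is generated as a field over $\mathbb{Q}$ by finitely many elements that are algebraically independent over $\mathbb{Q}$. Consequently the field $\mathbb{Q}(D_6)=\mathbb{Q}(x_g : g\in D_6)^{D_6}$ is also rational over $\mathbb{Q}$, where $D_6$ acts on the rational function field $\mathbb{Q}(x_g : g\in D_6)$ in twelve variables by the $\mathbb{Q}$-automorphisms with $g\cdot x_h=x_{gh}$ for all $g,h\in D_6$. -/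

import Mathlib

namespace NoetherProblem

/-- The intermediate field `F` of `E / K` is rational (purely transcendental, of finite
transcendence degree) over `K`: `F = K(x₁, …, xₙ)` for some finite family `x₁, …, xₙ` that is
algebraically independent over `K`. -/
def IsRational {K E : Type*} [Field K] [Field E] [Algebra K E] (F : IntermediateField K E) :
    Prop :=
  ∃ (n : ℕ) (x : Fin n → E),
    AlgebraicIndependent K x ∧ IntermediateField.adjoin K (Set.range x) = F

/-- The rational function field `K(y_i : i ∈ ι)`. -/
abbrev RatFunField (K ι : Type*) [Field K] : Type _ := FractionRing (MvPolynomial ι K)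

/-- The usual `K`-algebra structure of `K(y_i : i ∈ ι)`, repeated here so that for `K = ℚ` it is
found before the (propositionally equal) one that every field of characteristic zero has. -/
noncomputable instance (priority := 2000) instAlgebraRatFunField (K ι : Type*) [Field K] :
    Algebra K (RatFunField K ι) :=
  OreLocalization.instAlgebra

/-- The variable `y_i` as an element of `K(y_i : i ∈ ι)`. -/
noncomputable def var (K : Type*) {ι : Type*} [Field K] (i : ι) : RatFunField K ι :=
  algebraMap (MvPolynomial ι K) (RatFunField K ι) (MvPolynomial.X i)

/-- The unique extension of `K`-automorphisms of the polynomial ring `K[y_i : i ∈ ι]` to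
`K`-automorphisms of its fraction field `K(y_i : i ∈ ι)`, as a group homomorphism. -/
noncomputable def extendAut (K ι : Type*) [Field K] :
    (MvPolynomial ι K ≃ₐ[K] MvPolynomial ι K) →* (RatFunField K ι ≃ₐ[K] RatFunField K ι) :=
  IsFractionRing.fieldEquivOfAlgEquivHom K (RatFunField K ι)

theorem extendAut_algebraMap (K ι : Type*) [Field K]
    (f : MvPolynomial ι K ≃ₐ[K] MvPolynomial ι K) (p : MvPolynomial ι K) :
    extendAut K ι f (algebraMap _ (RatFunField K ι) p) = algebraMap _ (RatFunField K ι) (f p) :=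
  IsFractionRing.fieldEquivOfAlgEquiv_algebraMap K (RatFunField K ι) (RatFunField K ι) f p

/-- The fixed field `E ^ G = {f ∈ E : g · f = f for every g ∈ G}` of a group `G` that acts on a
field `E` by `K`-automorphisms. -/
noncomputable def fixedFieldOf {K E G : Type*} [Field K] [Field E] [Algebra K E] [Group G]
    (ρ : G →* (E ≃ₐ[K] E)) : IntermediateField K E :=
  IntermediateField.fixedField ρ.range

theorem mem_fixedFieldOf {K E G : Type*} [Field K] [Field E] [Algebra K E] [Group G]
    (ρ : G →* (E ≃ₐ[K] E)) (f : E) : f ∈ fixedFieldOf ρ ↔ ∀ g : G, ρ g f = f := by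
  simp [fixedFieldOf]

/-! ### The regular action and the field `K(G)` -/

/-- The action of `G` on the polynomial ring `K[x_g : g ∈ G]` with `g · x_h = x_{gh}`. -/
noncomputable def regularPolyAction (K G : Type*) [Field K] [Group G] :
    G →* (MvPolynomial G K ≃ₐ[K] MvPolynomial G K) where
  toFun g := MvPolynomial.renameEquiv K (Equiv.mulLeft g)
  map_one' := by
    ext p : 1
    simp [Equiv.Perm.one_def]
  map_mul' g h := by
    ext p : 1
    simp only [MvPolynomial.renameEquiv_apply, AlgEquiv.mul_apply, MvPolynomial.rename_rename,
      Equiv.mulLeft_mul, Equiv.Perm.coe_mul]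

/-- The action of `G` on the field `K(x_g : g ∈ G)` by `K`-automorphisms with
`g · x_h = x_{gh}`. -/
noncomputable def regularAction (K G : Type*) [Field K] [Group G] :
    G →* (RatFunField K G ≃ₐ[K] RatFunField K G) :=
  (extendAut K G).comp (regularPolyAction K G)

theorem regularAction_var (K G : Type*) [Field K] [Group G] (g h : G) :
    regularAction K G g (var K h) = var K (g * h) := by
  simp [regularAction, regularPolyAction, var, extendAut_algebraMap]

/-- The field `K(G) = K(x_g : g ∈ G) ^ G` of Noether's problem. -/
noncomputable def noetherField (K G : Type*) [Field K] [Group G] :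
    IntermediateField K (RatFunField K G) :=
  fixedFieldOf (regularAction K G)

/-! ### The three-dimensional action of the dihedral group of order 12 -/

/-- `σ : y₀ ↦ y₁ ↦ y₂ ↦ -y₀` on the polynomial ring `K[y₀, y₁, y₂]`. -/
noncomputable def sigmaPoly (K : Type*) [Field K] :
    MvPolynomial (Fin 3) K ≃ₐ[K] MvPolynomial (Fin 3) K :=
  AlgEquiv.ofAlgHom
    (MvPolynomial.aeval ![MvPolynomial.X 1, MvPolynomial.X 2, -MvPolynomial.X 0])
    (MvPolynomial.aeval ![-MvPolynomial.X 2, MvPolynomial.X 0, MvPolynomial.X 1])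
    (by ext i : 1; fin_cases i <;> simp)
    (by ext i : 1; fin_cases i <;> simp)

/-- `τ : y₀ ↦ y₀, y₁ ↦ -y₂, y₂ ↦ -y₁` on the polynomial ring `K[y₀, y₁, y₂]`. -/
noncomputable def tauPoly (K : Type*) [Field K] :
    MvPolynomial (Fin 3) K ≃ₐ[K] MvPolynomial (Fin 3) K :=
  AlgEquiv.ofAlgHom
    (MvPolynomial.aeval ![MvPolynomial.X 0, -MvPolynomial.X 2, -MvPolynomial.X 1])
    (MvPolynomial.aeval ![MvPolynomial.X 0, -MvPolynomial.X 2, -MvPolynomial.X 1])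
    (by ext i : 1; fin_cases i <;> simp)
    (by ext i : 1; fin_cases i <;> simp)

theorem algEquiv_ext_X {K : Type*} [Field K]
    {f g : MvPolynomial (Fin 3) K ≃ₐ[K] MvPolynomial (Fin 3) K}
    (h : ∀ i, f (MvPolynomial.X i) = g (MvPolynomial.X i)) : f = g := by
  have h' : (f : MvPolynomial (Fin 3) K →ₐ[K] MvPolynomial (Fin 3) K) = g :=
    MvPolynomial.algHom_ext h
  ext p : 1
  exact DFunLike.congr_fun h' p

theorem sigmaPoly_X (K : Type*) [Field K] :
    sigmaPoly K (MvPolynomial.X 0) = MvPolynomial.X 1 ∧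
      sigmaPoly K (MvPolynomial.X 1) = MvPolynomial.X 2 ∧
      sigmaPoly K (MvPolynomial.X 2) = -MvPolynomial.X 0 := by
  simp [sigmaPoly]

theorem tauPoly_X (K : Type*) [Field K] :
    tauPoly K (MvPolynomial.X 0) = MvPolynomial.X 0 ∧
      tauPoly K (MvPolynomial.X 1) = -MvPolynomial.X 2 ∧
      tauPoly K (MvPolynomial.X 2) = -MvPolynomial.X 1 := by
  simp [tauPoly]

theorem sigmaPoly_pow_six (K : Type*) [Field K] : sigmaPoly K ^ 6 = 1 := by
  obtain ⟨h0, h1, h2⟩ := sigmaPoly_X K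
  refine algEquiv_ext_X fun i => ?_
  simp only [pow_succ, pow_zero, one_mul, AlgEquiv.mul_apply, AlgEquiv.one_apply]
  fin_cases i <;> simp [h0, h1, h2]

theorem tauPoly_mul_self (K : Type*) [Field K] : tauPoly K * tauPoly K = 1 := by
  obtain ⟨h0, h1, h2⟩ := tauPoly_X K
  refine algEquiv_ext_X fun i => ?_
  fin_cases i <;> simp [h0, h1, h2]

theorem sigmaPoly_mul_tauPoly_mul_sigmaPoly (K : Type*) [Field K] :
    sigmaPoly K * tauPoly K * sigmaPoly K = tauPoly K := by
  obtain ⟨h0, h1, h2⟩ := sigmaPoly_X K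
  obtain ⟨k0, k1, k2⟩ := tauPoly_X K
  refine algEquiv_ext_X fun i => ?_
  fin_cases i <;> simp [h0, h1, h2, k0, k1, k2]

/-- The homomorphism from the dihedral group of order `2n` to a group `H` that sends the rotation
`r 1` to `s` and the reflection `sr 0` to `t`, where `s ^ n = 1`, `t * t = 1` and
`s * t * s = t`. -/
def dihedralLift {n : ℕ} [NeZero n] {H : Type*} [Group H] (s t : H) (hs : s ^ n = 1)
    (ht : t * t = 1) (hst : s * t * s = t) : DihedralGroup n →* H :=
  MonoidHom.mk'
    (fun g => match g with
      | .r i => s ^ i.val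
      | .sr i => t * s ^ i.val)
    (by
      have hadd : ∀ i j : ZMod n, s ^ (i + j).val = s ^ i.val * s ^ j.val := fun i j => by
        rw [ZMod.val_add, ← pow_add, ← pow_mod_orderOf,
          Nat.mod_mod_of_dvd _ (orderOf_dvd_of_pow_eq_one hs), pow_mod_orderOf]
      have hk : ∀ k : ℕ, s ^ k * t * s ^ k = t := fun k => by
        induction k with
        | zero => simp
        | succ k ih =>
          calc s ^ (k + 1) * t * s ^ (k + 1) = s ^ k * (s * t * s) * s ^ k := by
                rw [pow_succ s k]; nth_rewrite 2 [← pow_succ]; rw [pow_succ']; group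
            _ = t := by rw [hst, ih]
      have hsub : ∀ i j : ZMod n, s ^ i.val * t * s ^ j.val = t * s ^ (j - i).val := fun i j => by
        conv_lhs => rw [← sub_add_cancel j i, add_comm, hadd, ← mul_assoc, hk]
      rintro (i | i) (j | j)
      · exact hadd i j
      · change t * s ^ (j - i).val = s ^ i.val * (t * s ^ j.val)
        rw [← mul_assoc, hsub]
      · change t * s ^ (i + j).val = t * s ^ i.val * s ^ j.val
        rw [hadd, mul_assoc]
      · change s ^ (j - i).val = t * s ^ i.val * (t * s ^ j.val)
        rw [mul_assoc, ← mul_assoc (s ^ i.val), hsub, ← mul_assoc, ht, one_mul])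

/-- The action of `D₆ = ⟨σ, τ⟩` on the field `K(y₀, y₁, y₂)` by `K`-automorphisms, where
`σ = r 1 : y₀ ↦ y₁ ↦ y₂ ↦ -y₀` and `τ = sr 0 : y₀ ↦ y₀, y₁ ↦ -y₂, y₂ ↦ -y₁`. -/
noncomputable def dihedralAction (K : Type*) [Field K] :
    DihedralGroup 6 →* (RatFunField K (Fin 3) ≃ₐ[K] RatFunField K (Fin 3)) :=
  (extendAut K (Fin 3)).comp
    (dihedralLift (sigmaPoly K) (tauPoly K) (sigmaPoly_pow_six K) (tauPoly_mul_self K)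
      (sigmaPoly_mul_tauPoly_mul_sigmaPoly K))

theorem dihedralAction_sigma (K : Type*) [Field K] :
    dihedralAction K (.r 1) (var K 0) = var K 1 ∧ dihedralAction K (.r 1) (var K 1) = var K 2 ∧
      dihedralAction K (.r 1) (var K 2) = -var K 0 := by
  have h : (1 : ZMod 6).val = 1 := rfl
  obtain ⟨h0, h1, h2⟩ := sigmaPoly_X K
  refine ⟨?_, ?_, ?_⟩ <;>
    simp [dihedralAction, dihedralLift, var, extendAut_algebraMap, h, h0, h1, h2]

theorem dihedralAction_tau (K : Type*) [Field K] :
    dihedralAction K (.sr 0) (var K 0) = var K 0 ∧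
      dihedralAction K (.sr 0) (var K 1) = -var K 2 ∧
      dihedralAction K (.sr 0) (var K 2) = -var K 1 := by
  obtain ⟨h0, h1, h2⟩ := tauPoly_X K
  refine ⟨?_, ?_, ?_⟩ <;>
    simp [dihedralAction, dihedralLift, var, extendAut_algebraMap, h0, h1, h2]

end NoetherProblem

/-! Put `p = y₀ + y₁`, `q = y₁ + y₂`, `u = y₀ - y₁ + y₂`. The plane of `p`, `q` is the reflection
representation of the dihedral group, with basic invariants `s = p² - pq + q²` and `f = (pq(q -
p))²`, and `u` spans a sign character. The cubic `c` in `p`, `q` has the same character as `u`, so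
`u * c` is invariant, and it gives back `u` once `p` and `q` are known. Hence `s`, `f`, `u * c`
generate a field over which `K(y₀, y₁, y₂)` has degree at most 12 (`finrank_le_twelve`). By Artin's
theorem the degree over the fixed field is exactly 12, so the two fields agree; three generators in
transcendence degree 3 are algebraically independent.

For the regular representation, the triple embeds in the span of the `x_g`, and the other nine
variables are replaced by invariants (the no-name lemma, `exists_invariant_spanning_set`). The same
count then applies to 3 + 9 generators; `IsDihedralTriple.isRational_fixedFieldOf` treats both cases
at once. -/

namespace NoetherProblem

open IntermediateField Module

/-! ### Rationality of a fixed field by counting generators and degrees -/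

/-- A finite set of at most `trdeg` elements over which `E` is algebraic generates a rational
intermediate field. -/
theorem isRational_adjoin {K E : Type*} [Field K] [Field E] [Algebra K E] (S : Set E)
    (hS : S.Finite) (hcard : (S.ncard : Cardinal) ≤ Algebra.trdeg K E)
    [Algebra.IsAlgebraic (adjoin K S) E] : IsRational (adjoin K S) := by
  have : Finite S := hS
  let e : Fin S.ncard ≃ S := (Finite.equivFin S).symm
  have hr : Set.range (fun i => (e i : E)) = S := by
    ext z
    constructor
    · rintro ⟨i, rfl⟩
      exact (e i).2
    · exact fun hz => ⟨e.symm ⟨z, hz⟩, by simp⟩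
  have halg : Algebra.IsAlgebraic (Algebra.adjoin K (Set.range fun i => (e i : E))) E := by
    rw [hr]
    exact (isAlgebraic_adjoin_iff_top (F := K) (s := S)).1 inferInstance
  refine ⟨S.ncard, fun i => e i, ?_, by rw [hr]⟩
  refine (Algebra.IsAlgebraic.isTranscendenceBasis_of_lift_le_trdeg_of_finite K _ ?_).1
  simpa using hcard

/-- A field generated by at most `trdeg` invariants over which `E` has degree at most `|G|` is the
fixed field of `G`, and it is rational. -/
theorem isRational_fixedFieldOf {K E G : Type*} [Field K] [Field E] [Algebra K E] [Group G]
    [Finite G] (ρ : G →* (E ≃ₐ[K] E)) (hρ : Function.Injective ρ) (S : Set E)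
    (hS : S.Finite) (hcard : (S.ncard : Cardinal) ≤ Algebra.trdeg K E)
    (hinv : ∀ z ∈ S, ∀ g, ρ g z = z) [FiniteDimensional (adjoin K S) E]
    (hfin : finrank (adjoin K S) E ≤ Nat.card G) : IsRational (fixedFieldOf ρ) := by
  have hle : adjoin K S ≤ fixedFieldOf ρ :=
    adjoin_le_iff.2 fun z hz => (mem_fixedFieldOf ρ z).2 (hinv z hz)
  have : Finite ρ.range := Finite.of_surjective _ ρ.rangeRestrict_surjective
  have hG : finrank (fixedFieldOf ρ) E = Nat.card G := by
    have := Fintype.ofFinite ρ.range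
    rw [Nat.card_congr (MonoidHom.ofInjective hρ).toEquiv, Nat.card_eq_fintype_card]
    exact FixedPoints.finrank_eq_card ρ.range E
  rw [← eq_of_le_of_finrank_le' hle (hG ▸ hfin)]
  exact isRational_adjoin S hS hcard

/-! ### Semilinear descent -/

/-- Traces of the powers of an element with pairwise distinct conjugates in `L` span, over `L`, the
orbits. -/
theorem mem_span_traces {K E G : Type*} [Field K] [Field E] [Algebra K E] [Group G]
    [Fintype G] (ρ : G →* (E ≃ₐ[K] E)) (L : IntermediateField K E) (θ : E)
    (hθ : ∀ g, ρ g θ ∈ L) (hinj : Function.Injective fun g => ρ g θ) (z : E) :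
    z ∈ Submodule.span L (Set.range fun k : ℕ => ∑ g, ρ g (θ ^ k * z)) := by
  let e := (Fintype.equivFin G).symm
  let v : Fin (Fintype.card G) → L := fun i => ⟨ρ (e i) θ, hθ _⟩
  have hv : Function.Injective v := fun i j h =>
    e.injective (hinj (congrArg (Subtype.val : L → E) h))
  have hdet := Matrix.det_vandermonde_ne_zero_iff.2 hv
  have hunit : IsUnit (Matrix.vandermonde v).det := isUnit_iff_ne_zero.2 hdet
  let A := (Matrix.vandermonde v)⁻¹
  have hA : Matrix.vandermonde v * A = 1 := Matrix.mul_nonsing_inv _ hunit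
  -- The traces are the Vandermonde matrix of the conjugates of `θ` applied to the orbit of `z`.
  -- Inverting it over `L` recovers the orbit, and `e.symm 1` indexes `z` itself.
  have hz : z = ∑ k, A k (e.symm 1) • ∑ g, ρ g (θ ^ (k : ℕ) * z) := by
    have h1 : ∀ k : Fin (Fintype.card G), ∑ g, ρ g (θ ^ (k : ℕ) * z) =
        ∑ i, Matrix.vandermonde v i k • ρ (e i) z := fun k => by
      rw [← e.sum_comp]
      refine Finset.sum_congr rfl fun i _ => ?_
      rw [map_mul, map_pow, Matrix.vandermonde_apply]
      rfl
    simp_rw [h1, Finset.smul_sum, smul_smul]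
    rw [Finset.sum_comm]
    simp_rw [← Finset.sum_smul, mul_comm (A _ _), ← Matrix.mul_apply, hA, Matrix.one_apply,
      ite_smul, one_smul, zero_smul]
    simp
  have hmem : ∑ k, A k (e.symm 1) • ∑ g, ρ g (θ ^ (k : ℕ) * z) ∈
      Submodule.span L (Set.range fun k : ℕ => ∑ g, ρ g (θ ^ k * z)) :=
    Submodule.sum_mem _ fun k _ => Submodule.smul_mem _ _ (Submodule.subset_span ⟨k, rfl⟩)
  rwa [← hz] at hmem

/-- A subspace that is stable under the (semilinear) action and contains `1` is spanned by `1` and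
few invariants. -/
theorem exists_invariant_spanning_set {K E G : Type*} [Field K] [Field E] [Algebra K E] [Group G]
    [Fintype G] (ρ : G →* (E ≃ₐ[K] E)) (L : IntermediateField K E) (θ : E)
    (hθ : ∀ g, ρ g θ ∈ L) (hinj : Function.Injective fun g => ρ g θ) {m : ℕ} (x : Fin m → E)
    (hx : ∀ g i, ρ g (x i) ∈ Submodule.span L (insert 1 (Set.range x))) :
    ∃ B : Set E, B.Finite ∧ B.ncard ≤ m ∧ (∀ z ∈ B, ∀ g, ρ g z = z) ∧
      ∀ i, x i ∈ Submodule.span L (insert 1 B) := by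
  set N := Submodule.span L (insert 1 (Set.range x)) with hN
  let T : Set E := {z | z ∈ N ∧ ∀ g, ρ g z = z}
  have h1 : (1 : E) ∈ T := ⟨Submodule.subset_span (Set.mem_insert _ _), fun g => map_one _⟩
  have htr : ∀ i (k : ℕ), ∑ g, ρ g (θ ^ k * x i) ∈ T := fun i k => by
    refine ⟨Submodule.sum_mem _ fun g _ => ?_, fun h => ?_⟩
    · rw [map_mul, map_pow]
      exact Submodule.smul_mem N ((⟨ρ g θ, hθ g⟩ : L) ^ k) (hx g i)
    · rw [map_sum, ← Equiv.sum_comp (Equiv.mulLeft h) (fun g => ρ g (θ ^ k * x i))]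
      exact Finset.sum_congr rfl fun g _ => by simp
  -- The basis is made to contain `1`: it has at most `m + 1` elements, so discarding `1` leaves at
  -- most `m`.
  obtain ⟨b, hbT, h1b, hTb, hli⟩ := exists_linearIndepOn_id_extension (K := L) (V := E)
    (s := {1}) (t := T) (LinearIndepOn.singleton one_ne_zero) (by simpa using h1)
  have hfinset : (insert 1 (Set.range x)).Finite := (Set.finite_range x).insert 1
  have := hfinset.fintype
  have hbN : Set.range ((↑) : b → E) ≤ Submodule.span L (insert 1 (Set.range x)) := by
    rintro _ ⟨z, rfl⟩
    exact (hbT z.2).1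
  have hbfin : Finite b := hli.finite_of_le_span_finite _ _ hbN
  have hbcard : b.ncard ≤ m + 1 := by
    have := Fintype.ofFinite b
    have h := linearIndependent_le_span_aux' _ hli _ hbN
    rw [← Nat.card_eq_fintype_card, ← Nat.card_eq_fintype_card, Nat.card_coe_set_eq,
      Nat.card_coe_set_eq] at h
    refine h.trans ((Set.ncard_insert_le _ _).trans ?_)
    have h2 := Set.ncard_image_le (f := x) (s := Set.univ) Set.finite_univ
    rw [Set.image_univ, Set.ncard_univ, Nat.card_fin] at h2
    omega
  refine ⟨b \ {1}, Set.Finite.sdiff hbfin, ?_, fun z hz => (hbT hz.1).2, fun i => ?_⟩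
  · rw [Set.ncard_sdiff_singleton_of_mem (by simpa using h1b)]
    omega
  · rw [Set.insert_sdiff_singleton, Set.insert_eq_of_mem (by simpa using h1b)]
    refine Submodule.span_le.2 ?_ (mem_span_traces ρ L θ hθ hinj (x i))
    rintro _ ⟨k, rfl⟩
    exact hTb (htr i k)

/-! ### The degree bound for the reflection representation -/

theorem finrank_adjoin_simple_le {F E : Type*} [Field F] [Field E] [Algebra F E] {a : E}
    {P : Polynomial F} (hP : P.Monic) (ha : Polynomial.aeval a P = 0) :
    FiniteDimensional F F⟮a⟯ ∧ finrank F F⟮a⟯ ≤ P.natDegree := by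
  have hint : IsIntegral F a := ⟨P, hP, ha⟩
  refine ⟨adjoin.finiteDimensional hint, ?_⟩
  rw [adjoin.finrank hint]
  exact Polynomial.natDegree_le_of_dvd (minpoly.dvd F a ha) hP.ne_zero

/-- The degree of the function field of the reflection representation of the dihedral group of
order 12 over the field generated by the invariants of degrees 2 and 6. -/
theorem finrank_le_twelve {F E : Type*} [Field F] [Field E] [Algebra F E] {p q : E} {s f : F}
    (hs : algebraMap F E s = p ^ 2 - p * q + q ^ 2)
    (hf : algebraMap F E f = (p * q * (q - p)) ^ 2)
    (htop : ∀ M : IntermediateField F E, p ∈ M → q ∈ M → M = ⊤) :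
    FiniteDimensional F E ∧ finrank F E ≤ 12 := by
  -- Since `p² - s = q(p - q)`, the element `p` is a root of `X²(X² - s)² - f`.
  have h1 := finrank_adjoin_simple_le (a := p) (F := F)
    (P := .X ^ 6 + .C (-(2 * s)) * .X ^ 4 + .C (s ^ 2) * .X ^ 2 + .C (-f))
    (by monicity!) (by simp only [map_add, map_mul, map_neg, map_pow, Polynomial.aeval_X,
      Polynomial.aeval_C, hs, hf, map_ofNat]; ring)
  have d1 : (.X ^ 6 + .C (-(2 * s)) * .X ^ 4 + .C (s ^ 2) * .X ^ 2 + .C (-f) :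
      Polynomial F).natDegree = 6 := by compute_degree!
  rw [d1] at h1
  let p' : F⟮p⟯ := ⟨p, mem_adjoin_simple_self F p⟩
  -- The equation defining `s`, read as a quadratic in `q`.
  have h2 := finrank_adjoin_simple_le (a := q) (F := F⟮p⟯)
    (P := .X ^ 2 + .C (-p') * .X + .C (p' ^ 2 - algebraMap F _ s))
    (by monicity!) (by
      have e1 : algebraMap F⟮p⟯ E p' = p := rfl
      have e2 : algebraMap F⟮p⟯ E (algebraMap F _ s) = p ^ 2 - p * q + q ^ 2 := by
        rw [← hs]; rfl
      simp only [map_add, map_mul, map_neg, map_pow, map_sub, Polynomial.aeval_X,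
        Polynomial.aeval_C, e1, e2]; ring)
  have d2 : (.X ^ 2 + .C (-p') * .X + .C (p' ^ 2 - algebraMap F _ s) :
      Polynomial F⟮p⟯).natDegree = 2 := by compute_degree!
  rw [d2] at h2
  have htop' : F⟮p⟯⟮q⟯ = ⊤ := by
    have := htop (F⟮p⟯⟮q⟯.restrictScalars F)
      (F⟮p⟯⟮q⟯.algebraMap_mem p') (mem_adjoin_simple_self F⟮p⟯ q)
    exact restrictScalars_injective F (this.trans (restrictScalars_top (K := F)).symm)
  rw [htop', finrank_top'] at h2
  have := h1.1
  have : FiniteDimensional F⟮p⟯ E := by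
    have := h2.1
    exact Module.Finite.equiv (topEquiv (F := F⟮p⟯) (E := E)).toLinearEquiv
  refine ⟨FiniteDimensional.trans F F⟮p⟯ E, ?_⟩
  rw [← Module.finrank_mul_finrank F F⟮p⟯ E]
  exact Nat.mul_le_mul h1.2 h2.2

/-! ### Fixed fields of actions containing a dihedral triple -/

theorem dihedralGroup_six_cases {P : DihedralGroup 6 → Prop}
    (hr : ∀ k < 6, P (.r 1 ^ k)) (hs : ∀ k < 6, P (.sr 0 * .r 1 ^ k)) (g : DihedralGroup 6) :
    P g := by
  rcases g with i | i
  · have := hr i.val (ZMod.val_lt i)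
    rwa [DihedralGroup.r_one_pow, ZMod.natCast_rightInverse i] at this
  · have := hs i.val (ZMod.val_lt i)
    rwa [DihedralGroup.r_one_pow, ZMod.natCast_rightInverse i, DihedralGroup.sr_mul_r,
      zero_add] at this

theorem dihedralGroup_six_fixed {K E : Type*} [Field K] [Field E] [Algebra K E]
    (ρ : DihedralGroup 6 →* (E ≃ₐ[K] E)) {z : E} (hσ : ρ (.r 1) z = z) (hτ : ρ (.sr 0) z = z)
    (g : DihedralGroup 6) : ρ g z = z := by
  have hpow : ∀ k : ℕ, ρ (.r 1 ^ k) z = z := fun k => by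
    induction k with
    | zero => simp
    | succ k ih => rw [pow_succ, map_mul, AlgEquiv.mul_apply, hσ, ih]
  refine dihedralGroup_six_cases (P := fun g => ρ g z = z) (fun k _ => hpow k) (fun k _ => ?_) g
  rw [map_mul, AlgEquiv.mul_apply, hpow, hτ]

/-- Elements `y₀, y₁, y₂` that the dihedral group of order 12 permutes up to sign as in the
three-dimensional representation. -/
structure IsDihedralTriple {K E : Type*} [Field K] [Field E] [Algebra K E]
    (ρ : DihedralGroup 6 →* (E ≃ₐ[K] E)) (y₀ y₁ y₂ : E) : Prop where
  r0 : ρ (.r 1) y₀ = y₁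
  r1 : ρ (.r 1) y₁ = y₂
  r2 : ρ (.r 1) y₂ = -y₀
  s0 : ρ (.sr 0) y₀ = y₀
  s1 : ρ (.sr 0) y₁ = -y₂
  s2 : ρ (.sr 0) y₂ = -y₁

section

variable {K E : Type*} [Field K] [Field E] [Algebra K E]
  {ρ : DihedralGroup 6 →* (E ≃ₐ[K] E)} {y₀ y₁ y₂ : E}

/-- The group acts by signed permutations, and 1, 2, 4 have distinct absolute values, so the
coefficients tell the group elements apart; the first two already single out the identity. -/
theorem IsDihedralTriple.apply_generic (h : IsDihedralTriple ρ y₀ y₁ y₂) (g : DihedralGroup 6) :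
    ∃ a b c : ℤ, ρ g (y₀ + 2 * y₁ + 4 * y₂) = a * y₀ + b * y₁ + c * y₂ ∧
      (g = 1 ∨ a ≠ 1 ∨ b ≠ 2) := by
  obtain ⟨r0, r1, r2, s0, s1, s2⟩ := h
  refine dihedralGroup_six_cases (P := fun g => ∃ a b c : ℤ,
    ρ g (y₀ + 2 * y₁ + 4 * y₂) = a * y₀ + b * y₁ + c * y₂ ∧ (g = 1 ∨ a ≠ 1 ∨ b ≠ 2)) ?_ ?_ g
  · intro k hk
    interval_cases k
    · exact ⟨1, 2, 4, by simp, by simp⟩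
    on_goal 1 => refine ⟨-4, 1, 2, ?_, by simp⟩
    on_goal 2 => refine ⟨-2, -4, 1, ?_, by simp⟩
    on_goal 3 => refine ⟨-1, -2, -4, ?_, by simp⟩
    on_goal 4 => refine ⟨4, -1, -2, ?_, by simp⟩
    on_goal 5 => refine ⟨2, 4, -1, ?_, by simp⟩
    all_goals
      simp only [pow_succ, pow_zero, one_mul, map_mul, AlgEquiv.mul_apply, map_add, map_neg,
        map_ofNat, r0, r1, r2]
      push_cast
      ring
  · intro k hk
    interval_cases k
    on_goal 1 => refine ⟨1, -4, -2, ?_, by simp⟩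
    on_goal 2 => refine ⟨-4, -2, -1, ?_, by simp⟩
    on_goal 3 => refine ⟨-2, -1, 4, ?_, by simp⟩
    on_goal 4 => refine ⟨-1, 4, 2, ?_, by simp⟩
    on_goal 5 => refine ⟨4, 2, 1, ?_, by simp⟩
    on_goal 6 => refine ⟨2, 1, -4, ?_, by simp⟩
    all_goals
      simp only [pow_succ, pow_zero, one_mul, mul_one, map_mul, AlgEquiv.mul_apply, map_add,
        map_neg, map_ofNat, r0, r1, r2, s0, s1, s2]
      push_cast
      ring

theorem IsDihedralTriple.injective_generic (h : IsDihedralTriple ρ y₀ y₁ y₂)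
    (hlin : ∀ a b c : ℤ, a * y₀ + b * y₁ + c * y₂ = 0 → a = 0 ∧ b = 0 ∧ c = 0) :
    Function.Injective fun g => ρ g (y₀ + 2 * y₁ + 4 * y₂) := by
  intro g k hgk
  have h1 : ρ (k⁻¹ * g) (y₀ + 2 * y₁ + 4 * y₂) = y₀ + 2 * y₁ + 4 * y₂ := by
    rw [map_mul, AlgEquiv.mul_apply]
    refine (congrArg (ρ k⁻¹) hgk).trans ?_
    rw [← AlgEquiv.mul_apply, ← map_mul, inv_mul_cancel, map_one, AlgEquiv.one_apply]
  obtain ⟨a, b, c, e, hab⟩ := h.apply_generic (k⁻¹ * g)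
  obtain ⟨ha, hb, -⟩ := hlin (a - 1) (b - 2) (c - 4) (by
    push_cast
    linear_combination h1 - e)
  rcases hab with hab | hab | hab
  · exact (inv_mul_eq_one.1 hab).symm
  · omega
  · omega

/-- If `E` is generated over `L = K(y₀, y₁, y₂)` by a family that spans, together with `1`, a
stable subspace over `L` and has no more elements than the transcendence degree allows, then the
fixed field is rational. -/
theorem IsDihedralTriple.isRational_fixedFieldOf (h : IsDihedralTriple ρ y₀ y₁ y₂)
    (hlin : ∀ a b c : ℤ, a * y₀ + b * y₁ + c * y₂ = 0 → a = 0 ∧ b = 0 ∧ c = 0)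
    {m : ℕ} (htr : Algebra.trdeg K E = (m + 3 : ℕ)) (x : Fin m → E)
    (hx : ∀ g i, ρ g (x i) ∈ Submodule.span (adjoin K {y₀, y₁, y₂}) (insert 1 (Set.range x)))
    (htop : adjoin K ({y₀, y₁, y₂} ∪ Set.range x) = ⊤) :
    IsRational (fixedFieldOf ρ) := by
  have hinj := h.injective_generic hlin
  set L := adjoin K {y₀, y₁, y₂} with hL
  have hy₀ : y₀ ∈ L := subset_adjoin _ _ (by simp)
  have hy₁ : y₁ ∈ L := subset_adjoin _ _ (by simp)
  have hy₂ : y₂ ∈ L := subset_adjoin _ _ (by simp)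
  have hθ : ∀ g, ρ g (y₀ + 2 * y₁ + 4 * y₂) ∈ L := fun g => by
    obtain ⟨a, b, c, e, -⟩ := h.apply_generic g
    rw [e]
    exact add_mem (add_mem (mul_mem (intCast_mem L a) hy₀) (mul_mem (intCast_mem L b) hy₁))
      (mul_mem (intCast_mem L c) hy₂)
  obtain ⟨B, hBfin, hBcard, hBinv, hxB⟩ := exists_invariant_spanning_set ρ L _ hθ hinj x hx
  have hρ : Function.Injective ρ := fun g k hgk => hinj (by simp only [hgk])
  -- Needed to solve for `y₁` from `p`, `q`, `u`.
  have h3 : (3 : E) ≠ 0 := fun h3 => by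
    have := hlin 3 0 0 (by push_cast; rw [h3]; ring)
    omega
  obtain ⟨r0, r1, r2, s0, s1, s2⟩ := h
  set p := y₀ + y₁ with hp
  set q := y₁ + y₂ with hq
  have rp : ρ (.r 1) p = q := by simp [hp, hq, r0, r1]
  have rq : ρ (.r 1) q = q - p := by simp [hp, hq, r1, r2]; ring
  have sp : ρ (.sr 0) p = p - q := by simp [hp, hq, s0, s1]; ring
  have sq : ρ (.sr 0) q = -q := by simp [hq, s1, s2]
  set u := y₀ - y₁ + y₂ with hu
  have ru : ρ (.r 1) u = -u := by simp [hu, r0, r1, r2]; ring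
  have su : ρ (.sr 0) u = u := by simp [hu, s0, s1, s2]; ring
  -- `σ` maps `p + q` to `2q - p`, then to `q - 2p`, then to `-(p + q)`, so it negates the product;
  -- `τ` fixes it, as it does `u`.
  set c := (p + q) * (2 * q - p) * (q - 2 * p) with hc
  have rc : ρ (.r 1) c = -c := by
    simp only [hc, map_mul, map_add, map_sub, map_ofNat, rp, rq]; ring
  have sc : ρ (.sr 0) c = c := by
    simp only [hc, map_mul, map_add, map_sub, map_ofNat, sp, sq]; ring
  have hc0 : c ≠ 0 := by
    refine mul_ne_zero (mul_ne_zero ?_ ?_) ?_ <;> intro h0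
    · have := hlin 1 2 1 (by push_cast; rw [← h0, hp, hq]; ring)
      omega
    · have := hlin (-1) 1 2 (by push_cast; rw [← h0, hp, hq]; ring)
      omega
    · have := hlin (-2) (-1) 1 (by push_cast; rw [← h0, hp, hq]; ring)
      omega
  let S : Set E := {p ^ 2 - p * q + q ^ 2, (p * q * (q - p)) ^ 2, u * c} ∪ B
  have hSfin : S.Finite := (Set.toFinite _).union hBfin
  have hScard : S.ncard ≤ m + 3 := by
    refine (Set.ncard_union_le _ _).trans ?_
    have := Set.ncard_insert_le (p ^ 2 - p * q + q ^ 2) {(p * q * (q - p)) ^ 2, u * c}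
    have := Set.ncard_insert_le ((p * q * (q - p)) ^ 2) {u * c}
    have := Set.ncard_singleton (u * c)
    omega
  have hSinv : ∀ z ∈ S, ∀ g, ρ g z = z := by
    rintro z ((rfl | rfl | rfl) | hz)
    · refine dihedralGroup_six_fixed ρ ?_ ?_ <;>
        simp only [map_mul, map_add, map_sub, map_pow, rp, rq, sp, sq] <;> ring
    · refine dihedralGroup_six_fixed ρ ?_ ?_ <;>
        simp only [map_mul, map_sub, map_pow, rp, rq, sp, sq] <;> ring
    · refine dihedralGroup_six_fixed ρ ?_ ?_ <;> simp [ru, rc, su, sc]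
    · exact hBinv z hz
  have hgen : ∀ M : IntermediateField (adjoin K S) E, p ∈ M → q ∈ M → M = ⊤ := by
    intro M hpM hqM
    have hSM : ∀ z ∈ S, z ∈ M := fun z hz => M.algebraMap_mem ⟨z, subset_adjoin K S hz⟩
    have hcM : c ∈ M := mul_mem (mul_mem (add_mem hpM hqM)
      (sub_mem (mul_mem (ofNat_mem M 2) hqM) hpM)) (sub_mem hqM (mul_mem (ofNat_mem M 2) hpM))
    have huM : u ∈ M := by
      rw [← mul_div_cancel_right₀ u hc0]
      exact div_mem (hSM _ (by simp [S])) hcM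
    have h1M : y₁ ∈ M := by
      have : y₁ = (p + q - u) / 3 := by rw [hp, hq, hu]; field_simp; ring
      rw [this]
      exact div_mem (sub_mem (add_mem hpM hqM) huM) (ofNat_mem M 3)
    have h0M : y₀ ∈ M := by
      have := sub_mem hpM h1M
      rwa [hp, add_sub_cancel_right] at this
    have h2M : y₂ ∈ M := by
      have := sub_mem hqM h1M
      rwa [hq, add_sub_cancel_left] at this
    have hyM : ({y₀, y₁, y₂} : Set E) ⊆ M.restrictScalars K := by
      rintro z (rfl | rfl | rfl) <;> assumption
    have hLM : L ≤ M.restrictScalars K := adjoin_le_iff.2 hyM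
    have hxM : ∀ i, x i ∈ M := fun i => by
      refine Submodule.span_induction (p := fun z _ => z ∈ M) ?_ (zero_mem M)
        (fun _ _ _ _ => add_mem) (fun a z _ hz => mul_mem (hLM a.2) hz) (hxB i)
      rintro z (rfl | hz)
      · exact one_mem M
      · exact hSM z (Or.inr hz)
    have hM : M.restrictScalars K = ⊤ := by
      rw [← top_le_iff, ← htop, adjoin_le_iff]
      rintro z (hz | ⟨i, rfl⟩)
      · exact hyM hz
      · exact hxM i
    exact eq_top_iff.2 fun z _ => (hM ▸ mem_top : z ∈ M.restrictScalars K)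
  have hsS : p ^ 2 - p * q + q ^ 2 ∈ adjoin K S := subset_adjoin K S (by simp [S])
  have hfS : (p * q * (q - p)) ^ 2 ∈ adjoin K S := subset_adjoin K S (by simp [S])
  have hfin := finrank_le_twelve (F := adjoin K S) (E := E)
    (s := ⟨p ^ 2 - p * q + q ^ 2, hsS⟩)
    (f := ⟨(p * q * (q - p)) ^ 2, hfS⟩) rfl rfl hgen
  have := hfin.1
  refine NoetherProblem.isRational_fixedFieldOf ρ hρ S hSfin ?_ hSinv ?_
  · rw [htr]
    exact_mod_cast hScard
  · rw [DihedralGroup.nat_card]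
    exact hfin.2

end

/-! ### The three-dimensional and the regular action -/

theorem trdeg_ratFunField (K ι : Type*) [Field K] [Fintype ι] :
    Algebra.trdeg K (RatFunField K ι) = (Fintype.card ι : ℕ) := by
  have : Algebra.IsAlgebraic (MvPolynomial ι K) (RatFunField K ι) :=
    IsLocalization.isAlgebraic _ (nonZeroDivisors (MvPolynomial ι K))
  have h := (IsTranscendenceBasis.mvPolynomial ι K).algebraMap_comp
    (A := RatFunField K ι) |>.lift_cardinalMk_eq_trdeg
  rw [Cardinal.mk_fintype, Cardinal.lift_natCast] at h
  rw [← Cardinal.lift_inj, ← h, Cardinal.lift_natCast]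

theorem adjoin_range_var (K ι : Type*) [Field K] :
    adjoin K (Set.range (var K : ι → RatFunField K ι)) = ⊤ := by
  rw [eq_top_iff]
  intro z _
  have hpoly : ∀ P : MvPolynomial ι K, algebraMap _ (RatFunField K ι) P ∈
      adjoin K (Set.range (var K : ι → RatFunField K ι)) := fun P => by
    induction P using MvPolynomial.induction_on with
    | C a =>
      rw [← MvPolynomial.algebraMap_eq, ← IsScalarTower.algebraMap_apply]
      exact IntermediateField.algebraMap_mem _ a
    | add P Q hP hQ => rw [map_add]; exact add_mem hP hQ
    | mul_X P i hP => rw [map_mul]; exact mul_mem hP (subset_adjoin _ _ ⟨i, rfl⟩)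
  obtain ⟨P, Q, rfl⟩ := IsLocalization.exists_mk'_eq (nonZeroDivisors (MvPolynomial ι K)) z
  rw [IsFractionRing.mk'_eq_div]
  exact div_mem (hpoly P) (hpoly Q)

theorem isRational_fixedFieldOf_dihedralAction (K : Type*) [Field K] [CharZero K] :
    IsRational (fixedFieldOf (dihedralAction K)) := by
  obtain ⟨r0, r1, r2⟩ := dihedralAction_sigma K
  obtain ⟨s0, s1, s2⟩ := dihedralAction_tau K
  -- Here `y₀, y₁, y₂` already generate everything, so the additional family is empty.
  refine IsDihedralTriple.isRational_fixedFieldOf (m := 0) ⟨r0, r1, r2, s0, s1, s2⟩ ?_ ?_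
    Fin.elim0 (fun _ i => i.elim0) ?_
  · intro a b c h
    have hP : ((a : MvPolynomial (Fin 3) K) * .X 0 + b * .X 1 + c * .X 2) = 0 := by
      apply IsFractionRing.injective (MvPolynomial (Fin 3) K) (RatFunField K (Fin 3))
      simpa [var] using h
    refine ⟨?_, ?_, ?_⟩
    · simpa using congrArg (MvPolynomial.eval ![1, 0, 0]) hP
    · simpa using congrArg (MvPolynomial.eval ![0, 1, 0]) hP
    · simpa using congrArg (MvPolynomial.eval ![0, 0, 1]) hP
  · simpa using trdeg_ratFunField K (Fin 3)
  · rw [← adjoin_range_var]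
    congr 1
    ext z
    simp [Fin.exists_fin_succ, eq_comm]

open DihedralGroup in
theorem isRational_noetherField_dihedralGroup_six (K : Type*) [Field K] [CharZero K] :
    IsRational (noetherField K (DihedralGroup 6)) := by
  let X : DihedralGroup 6 → RatFunField K (DihedralGroup 6) := var K
  have hX : ∀ g h, regularAction K (DihedralGroup 6) g (X h) = X (g * h) := regularAction_var K _
  -- `y₀` is the sum over the subgroup generated by `r 3` and `sr 0`, weighted by its character with
  -- `r 3 ↦ -1`, `sr 0 ↦ 1`; `y₁` and `y₂` are its translates by `r 1` and `r 2`.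
  set y₀ := X (r 0) + X (sr 0) - X (r 3) - X (sr 3) with hy₀
  set y₁ := X (r 1) + X (sr 5) - X (r 4) - X (sr 2) with hy₁
  set y₂ := X (r 2) + X (sr 4) - X (r 5) - X (sr 1) with hy₂
  have h : IsDihedralTriple (regularAction K (DihedralGroup 6)) y₀ y₁ y₂ := by
    constructor <;> simp only [hy₀, hy₁, hy₂, map_add, map_sub, hX]
    · rfl
    · rfl
    · change X (r 3) + X (sr 3) - X (r 0) - X (sr 0) = _
      ring
    · change X (sr 0) + X (r 0) - X (sr 3) - X (r 3) = _
      ring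
    · change X (sr 1) + X (r 5) - X (sr 4) - X (r 2) = _
      ring
    · change X (sr 2) + X (r 4) - X (sr 5) - X (r 1) = _
      ring
  -- Each of `X (r 0)`, `X (r 1)`, `X (r 2)` occurs in exactly one `y`, so it is an affine
  -- combination over `L` of these nine. Hence their span with `1` contains all twelve variables and
  -- is stable.
  let i : Fin 9 → DihedralGroup 6 := ![r 3, r 4, r 5, sr 0, sr 1, sr 2, sr 3, sr 4, sr 5]
  have hi : ∀ g, g = r 0 ∨ g = r 1 ∨ g = r 2 ∨ ∃ k, i k = g := by decide
  have hr0 : X (r 0) = y₀ - X (i 3) + X (i 0) + X (i 6) := by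
    change X (r 0) = y₀ - X (sr 0) + X (r 3) + X (sr 3)
    rw [hy₀]; ring
  have hr1 : X (r 1) = y₁ - X (i 8) + X (i 1) + X (i 5) := by
    change X (r 1) = y₁ - X (sr 5) + X (r 4) + X (sr 2)
    rw [hy₁]; ring
  have hr2 : X (r 2) = y₂ - X (i 7) + X (i 2) + X (i 4) := by
    change X (r 2) = y₂ - X (sr 4) + X (r 5) + X (sr 1)
    rw [hy₂]; ring
  refine h.isRational_fixedFieldOf (m := 9) ?_ ?_ (fun k => X (i k)) (fun g k => ?_) ?_
  · intro a b c h
    have hP : (a * (.X (r 0) + .X (sr 0) - .X (r 3) - .X (sr 3)) +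
        b * (.X (r 1) + .X (sr 5) - .X (r 4) - .X (sr 2)) +
        c * (.X (r 2) + .X (sr 4) - .X (r 5) - .X (sr 1)) :
        MvPolynomial (DihedralGroup 6) K) = 0 := by
      apply IsFractionRing.injective _ (RatFunField K (DihedralGroup 6))
      simpa [var, hy₀, hy₁, hy₂, X] using h
    -- Evaluation at the indicator function of `g` reads off the coefficient of `X g`.
    have he := fun g => congrArg (MvPolynomial.eval fun h => if h = g then 1 else 0) hP
    refine ⟨?_, ?_, ?_⟩
    · simpa +decide using he (r 0)
    · simpa +decide using he (r 1)
    · simpa +decide using he (r 2)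
  · have := trdeg_ratFunField K (DihedralGroup 6)
    rwa [DihedralGroup.card] at this
  · set L := adjoin K {y₀, y₁, y₂}
    set N := Submodule.span L (insert 1 (Set.range fun k => X (i k)))
    have hL : ∀ z ∈ L, z ∈ N := fun z hz => by
      have := N.smul_mem (⟨z, hz⟩ : L) (Submodule.subset_span (Set.mem_insert 1 _))
      rwa [Algebra.smul_def, mul_one] at this
    have hk : ∀ k, X (i k) ∈ N := fun k => Submodule.subset_span (Or.inr ⟨k, rfl⟩)
    have hy : ∀ y ∈ ({y₀, y₁, y₂} : Set _), y ∈ N := fun y hy => hL y (subset_adjoin _ _ hy)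
    rw [hX]
    rcases hi (g * i k) with e | e | e | ⟨j, e⟩
    · rw [e, hr0]
      exact add_mem (add_mem (sub_mem (hy _ (by simp)) (hk _)) (hk _)) (hk _)
    · rw [e, hr1]
      exact add_mem (add_mem (sub_mem (hy _ (by simp)) (hk _)) (hk _)) (hk _)
    · rw [e, hr2]
      exact add_mem (add_mem (sub_mem (hy _ (by simp)) (hk _)) (hk _)) (hk _)
    · rw [← e]
      exact hk j
  · rw [← top_le_iff, ← adjoin_range_var, adjoin_le_iff]
    set M := adjoin K ({y₀, y₁, y₂} ∪ Set.range fun k => X (i k))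
    have hk : ∀ k, X (i k) ∈ M := fun k => subset_adjoin _ _ (Or.inr ⟨k, rfl⟩)
    have hy : ∀ y ∈ ({y₀, y₁, y₂} : Set _), y ∈ M :=
      fun y hy => subset_adjoin _ _ (Or.inl hy)
    rintro _ ⟨g, rfl⟩
    change X g ∈ M
    rcases hi g with rfl | rfl | rfl | ⟨j, rfl⟩
    · rw [hr0]
      exact add_mem (add_mem (sub_mem (hy _ (by simp)) (hk _)) (hk _)) (hk _)
    · rw [hr1]
      exact add_mem (add_mem (sub_mem (hy _ (by simp)) (hk _)) (hk _)) (hk _)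
    · rw [hr2]
      exact add_mem (add_mem (sub_mem (hy _ (by simp)) (hk _)) (hk _)) (hk _)
    · exact hk j

end NoetherProblem

theorem theorem4p1 :
    NoetherProblem.IsRational
        (NoetherProblem.fixedFieldOf (NoetherProblem.dihedralAction ℚ)) ∧
      NoetherProblem.IsRational (NoetherProblem.noetherField ℚ (DihedralGroup 6)) :=
  ⟨NoetherProblem.isRational_fixedFieldOf_dihedralAction ℚ,
    NoetherProblem.isRational_noetherField_dihedralGroup_six ℚ⟩
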